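/- Let $k=\mathbb F_q$ be a finite field with algebraic closure $\bar k$, let $n\ge 0$, let $GL_n=GL_n(k)$ and $N=|GL_n|$, and let $d$ be a positive integer with $d\mid N$ or $N\mid d$. If $d\mid N$, let $\mathrm{Gal}(N,d)$ be the Galois group of $\mathbb Q(\zeta_N)$ over $\mathbb Q(\zeta_d)$; if $N\mid d$, let $\mathrm{Gal}(N,d)$ be trivial. For $\sigma\in\mathrm{Gal}(N,d)$ let $r=r_\sigma$ be the integer modulo $N$, coprime to $N$, with $\sigma(\zeta_N)=\zeta_N^{\,r}$. The group $\mathrm{Gal}(N,d)$ acts on the conjugacy classes of $GL_n$: $\sigma$ sends the class of $g$ to the class of $g^{r}$. The $d$-Galois classes of $GL_n$ are the unions of the conjugacy classes in the orbits of this action (one union for each orbit). Let $\Phi$ be the set of monic irreducible polynomials $f\ne t$ in $k[t]$ and $\mathscr P$ the set of all partitions. Let $\boldsymbol\mu:\Phi\to\mathscr P$ be a function with $\|\boldsymbol\mu\|=\sum_{f\in\Phi}|\boldsymbol\mu(f)|\deg f=n$. For $f=t^s-\sum_{i=1}^{s}a_it^{i-1}\in\Phi$ let $J(f)$ be the $s\times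 s$ companion matrix with ones directly above the diagonal, last row $(a_1,\dots,a_s)$ and zeros elsewhere; let $J_m(f)$ be the block matrix with $m$ diagonal blocks $J(f)$, identity blocks $I_s$ directly above them and zeros elsewhere; and let $J_\lambda(f)=\bigoplus_i J_{\lambda_i}(f)$ for a partition $\lambda=(\lambda_1,\lambda_2,\dots)$. Let $c_{\boldsymbol\mu}$ be the conjugacy class in $GL_n$ of $g_{\boldsymbol\mu}=\bigoplus_{f\in\Phi}J_{\boldsymbol\mu(f)}(f)$. For $\sigma\in\mathrm{Gal}(N,d)$ and $f\in\Phi$ with $\deg f\le n$, write $f=\prod_x(t-x)$ over $\bar k$ and put $\sigma.f=\prod_x(t-x^{r_\sigma})$, which is again an element of $\Phi$, of the same degree. Define $\sigma.\boldsymbol\mu:\Phi\to\mathscr P$ by $(\sigma.\boldsymbol\mu)(f)=\boldsymbol\mu(\sigma^{-1}.f)$ if $\deg f\le n$, and $(\sigma.\boldsymbol\mu)(f)=\emptyset$ if $\deg f>n$ (note that $\boldsymbol\mu(f)=\emptyset$ for $\deg f>n$). Let $\mathsf O_d(\boldsymbol\mu)=\{\sigma.\boldsymbol\mu:\sigma\in\mathrm{Gal}(N,d)\}$.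 **Theorem.** Let $\boldsymbol\mu,\boldsymbol\nu:\Phi\to\mathscr P$ with $\|\boldsymbol\mu\|=\|\boldsymbol\nu\|=n$. Then $c_{\boldsymbol\mu}$ and $c_{\boldsymbol\nu}$ lie in the same $d$-Galois class of $GL_n$ if and only if $\mathsf O_d(\boldsymbol\mu)=\mathsf O_d(\boldsymbol\nu)$. -/

import Mathlib

open Polynomial

/-! ### Galois groups of cyclotomic fields and Galois classes of a finite group -/

/-- The subfield of `ℚ(ζ_N)` generated by the `d`-th roots of unity that it contains. This is
`ℚ(ζ_d)` if `d ∣ N`, and it is all of `ℚ(ζ_N)` if `N ∣ d`. -/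
noncomputable def cyclotomicSubfield (N d : ℕ) : IntermediateField ℚ (CyclotomicField N ℚ) :=
  IntermediateField.adjoin ℚ {z : CyclotomicField N ℚ | z ^ d = 1}

/-- `Gal(N, d)`, the Galois group of `ℚ(ζ_N)` over `ℚ(ζ_d)` (for `d ∣ N`; it is trivial for
`N ∣ d`). -/
abbrev CyclotomicGal (N d : ℕ) : Type :=
  CyclotomicField N ℚ ≃ₐ[cyclotomicSubfield N d] CyclotomicField N ℚ

instance cyclotomicField_isCyclotomicExtension (N : ℕ) [NeZero N] :
    IsCyclotomicExtension {N} ℚ (CyclotomicField N ℚ) :=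
  CyclotomicField.isCyclotomicExtension N ℚ

/-- The exponent `r` with `σ ζ_N = ζ_N ^ r`; it is the representative in `{0, …, N - 1}` of a unit
modulo `N`. (Only for `N = 1` does this give `0`.) -/
noncomputable def galExponent {N d : ℕ} [NeZero N] (σ : CyclotomicGal N d) : ℕ :=
  (((IsCyclotomicExtension.zeta_spec N ℚ (CyclotomicField N ℚ)).autToPow
    (cyclotomicSubfield N d) σ : (ZMod N)ˣ) : ZMod N).val

/-- The action of `Gal(|G|, d)` on the conjugacy classes of `G` that sends the class of `g` to the
class of `g ^ r`, where `σ ζ = ζ ^ r`. -/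
noncomputable def galConjClass {G : Type*} [Group G] [Finite G] {d : ℕ}
    (σ : CyclotomicGal (Nat.card G) d) : ConjClasses G → ConjClasses G :=
  Quotient.map (fun g : G => g ^ galExponent σ) fun _ _ h => IsConj.pow _ h

/-- The `d`-Galois classes of `G`: for every orbit of `Gal(|G|, d)` on the conjugacy classes, the
union of the conjugacy classes in the orbit. -/
def galoisClasses (d : ℕ) (G : Type*) [Group G] [Finite G] : Set (Set G) :=
  Set.range fun c : ConjClasses G =>
    ⋃ σ : CyclotomicGal (Nat.card G) d, (galConjClass σ c).carrier

/-! ### Partition-valued functions -/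

/-- The monic irreducible polynomials over `k` other than `t`, that is, the minimal polynomials of
the nonzero elements of an algebraic closure of `k`. -/
abbrev MonicIrred (k : Type*) [Field k] : Type _ :=
  {f : k[X] // f.Monic ∧ Irreducible f ∧ f ≠ X}

/-- The set of all partitions (of all natural numbers). -/
abbrev AllPartitions : Type := Σ m : ℕ, m.Partition

namespace AllPartitions

/-- The size `|l|` of a partition. -/
abbrev size (l : AllPartitions) : ℕ := l.1

/-- The empty partition. -/
def empty : AllPartitions := ⟨0, Nat.Partition.indiscrete 0⟩

/-- The parts of a partition in weakly decreasing order. -/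
def partList (l : AllPartitions) : List ℕ := l.2.parts.sort (· ≥ ·)

theorem sum_partList (l : AllPartitions) : l.partList.sum = l.size := by
  have h : (l.partList : Multiset ℕ) = l.2.parts := Multiset.sort_eq _ _
  rw [← Multiset.sum_coe, h, l.2.parts_sum]

end AllPartitions

/-- Functions `μ` from the monic irreducible polynomials `f ≠ t` to partitions with
`‖μ‖ = ∑ |μ(f)| deg f = n`, a sum with finitely many nonzero terms. -/
structure PartitionFunction (k : Type*) [Field k] (n : ℕ) where
  toFun : MonicIrred k → AllPartitions
  finite_support : {f | (toFun f).size ≠ 0}.Finite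
  norm_eq : ∑ᶠ f, (toFun f).size * f.1.natDegree = n

/-! ### The conjugacy class attached to a partition-valued function -/

/-- The companion matrix `J(f)` of a monic polynomial `f = t^s - ∑_{i=1}^s a_i t^(i-1)`, with ones
above the diagonal and last row `(a_1, …, a_s)`. -/
def companionMatrix {k : Type*} [Field k] (f : k[X]) :
    Matrix (Fin f.natDegree) (Fin f.natDegree) k :=
  Matrix.of fun i j =>
    if (i : ℕ) + 1 = f.natDegree then -f.coeff j else if (j : ℕ) = i + 1 then 1 else 0

/-- The block matrix `J_m(f)` with `m` diagonal blocks `J(f)` and identity blocks right above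
them. -/
def jordanBlock {k : Type*} [Field k] (m : ℕ) (f : k[X]) :
    Matrix (Fin m × Fin f.natDegree) (Fin m × Fin f.natDegree) k :=
  Matrix.of fun a b =>
    if a.1 = b.1 then companionMatrix f a.2 b.2
    else if (b.1 : ℕ) = a.1 + 1 ∧ a.2 = b.2 then 1 else 0

/-- `J_l(f) = ⊕_i J_{l_i}(f)` for a partition `l = (l_1, l_2, …)`. -/
def jordanPartition {k : Type*} [Field k] (l : AllPartitions) (f : k[X]) :
    Matrix (Σ i : Fin l.partList.length, Fin (l.partList.get i) × Fin f.natDegree)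
      (Σ i : Fin l.partList.length, Fin (l.partList.get i) × Fin f.natDegree) k :=
  Matrix.blockDiagonal' fun i => jordanBlock (l.partList.get i) f

namespace PartitionFunction

variable {k : Type*} [Field k] {n : ℕ}

/-- The polynomials `f` for which `μ(f)` is not the empty partition. -/
abbrev Support (μ : PartitionFunction k n) : Type _ := {f : MonicIrred k // (μ.toFun f).size ≠ 0}

/-- The index set of the rows and columns of `g_μ`. -/
abbrev Index (μ : PartitionFunction k n) : Type _ :=
  Σ f : μ.Support, Σ i : Fin (μ.toFun f.1).partList.length,
    Fin ((μ.toFun f.1).partList.get i) × Fin f.1.1.natDegree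

open Classical in
/-- The Jordan canonical form `g_μ = ⊕_f J_{μ(f)}(f)` (polynomials with `μ(f) = ∅` contribute no
block). -/
noncomputable def jordanForm (μ : PartitionFunction k n) : Matrix μ.Index μ.Index k :=
  Matrix.blockDiagonal' fun f : μ.Support => jordanPartition (μ.toFun f.1) f.1.1

theorem natCard_index (μ : PartitionFunction k n) : Nat.card μ.Index = n := by
  classical
  have : Fintype μ.Support := μ.finite_support.fintype
  have h : ∀ f : μ.Support, Nat.card (Σ i : Fin (μ.toFun f.1).partList.length,
      Fin ((μ.toFun f.1).partList.get i) × Fin f.1.1.natDegree) =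
      (μ.toFun f.1).size * f.1.1.natDegree := by
    intro f
    rw [Nat.card_sigma]
    simp only [Nat.card_prod, Nat.card_fin]
    rw [← Finset.sum_mul, ← (μ.toFun f.1).sum_partList]
    congr 1
    simp
  rw [Nat.card_sigma, Finset.sum_congr rfl fun f _ => h f]
  refine Eq.trans ?_ μ.norm_eq
  rw [finsum_eq_sum_of_support_subset (s := μ.finite_support.toFinset)]
  · exact (Finset.sum_subtype _ (by simp) fun f => (μ.toFun f).size * f.1.natDegree).symm
  · intro f hf
    simp only [Function.mem_support, ne_eq, mul_eq_zero, not_or] at hf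
    simpa using hf.1

end PartitionFunction

theorem isUnit_companionMatrix {k : Type*} [Field k] {f : k[X]} (h0 : f.coeff 0 ≠ 0) :
    IsUnit (companionMatrix f) := by
  rw [← Matrix.mulVec_injective_iff_isUnit]
  refine (injective_iff_map_eq_zero (companionMatrix f).mulVecLin).2 fun v hv => ?_
  have hrow : ∀ i, ∑ j, companionMatrix f i j * v j = 0 := fun i => congrFun hv i
  have hpos : ∀ j : Fin f.natDegree, (j : ℕ) ≠ 0 → v j = 0 := by
    intro j hj
    have hlt : (j : ℕ) - 1 < f.natDegree := by omega
    have h := hrow ⟨(j : ℕ) - 1, hlt⟩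
    rw [Finset.sum_eq_single j] at h
    · simpa [companionMatrix, show (j : ℕ) - 1 + 1 = j by omega, j.2.ne] using h
    · intro b _ hb
      have hb' : (b : ℕ) ≠ j := fun e => hb (Fin.ext e)
      simp [companionMatrix, show (j : ℕ) - 1 + 1 = j by omega, j.2.ne, hb']
    · simp
  funext j
  by_cases hj : (j : ℕ) = 0
  · have hlt : f.natDegree - 1 < f.natDegree := by omega
    have h := hrow ⟨f.natDegree - 1, hlt⟩
    rw [Finset.sum_eq_single j] at h
    · have hs : f.natDegree - 1 + 1 = f.natDegree := by omega
      simpa [companionMatrix, hs, hj, h0] using h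
    · intro b _ hb
      rw [hpos b fun e => hb (Fin.ext (e.trans hj.symm)), mul_zero]
    · simp
  · exact hpos j hj

theorem isUnit_jordanBlock {k : Type*} [Field k] {f : k[X]} (h0 : f.coeff 0 ≠ 0) (m : ℕ) :
    IsUnit (jordanBlock m f) := by
  have hJ := Matrix.mulVec_injective_iff_isUnit.2 (isUnit_companionMatrix h0)
  rw [← Matrix.mulVec_injective_iff_isUnit]
  refine (injective_iff_map_eq_zero (jordanBlock m f).mulVecLin).2 fun v hv => ?_
  have hrow : ∀ a i, ∑ b, ∑ j, jordanBlock m f (a, i) (b, j) * v (b, j) = 0 := fun a i => by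
    rw [← Fintype.sum_prod_type']
    exact congrFun hv (a, i)
  -- the coordinates in the blocks `m - 1, m - 2, …` vanish, one block after the other
  have key : ∀ t : ℕ, ∀ a : Fin m, (a : ℕ) + t + 1 = m → ∀ j, v (a, j) = 0 := by
    intro t
    induction t with
    | zero =>
      intro a ha
      refine fun j => congrFun (hJ (a₁ := fun j => v (a, j)) (a₂ := 0) ?_) j
      rw [Matrix.mulVec_zero]
      funext i
      have h := hrow a i
      rw [Finset.sum_eq_single a] at h
      · simpa [jordanBlock, Matrix.mulVec, dotProduct] using h
      · intro b _ hb
        have hb' : (b : ℕ) ≠ a + 1 := by omega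
        simp [jordanBlock, hb.symm, hb']
      · simp
    | succ t ih =>
      intro a ha
      refine fun j => congrFun (hJ (a₁ := fun j => v (a, j)) (a₂ := 0) ?_) j
      rw [Matrix.mulVec_zero]
      funext i
      have h := hrow a i
      rw [Finset.sum_eq_single a] at h
      · simpa [jordanBlock, Matrix.mulVec, dotProduct] using h
      · intro b _ hb
        refine Finset.sum_eq_zero fun j _ => ?_
        by_cases hb' : (b : ℕ) = a + 1
        · rw [ih b (by omega) j, mul_zero]
        · simp [jordanBlock, hb.symm, hb']
      · simp
  funext ⟨a, j⟩
  exact key (m - 1 - a) a (by omega) j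

theorem isUnit_blockDiagonal' {k o : Type*} [Field k] [Fintype o] [DecidableEq o] {m : o → Type*}
    [∀ i, Fintype (m i)] [∀ i, DecidableEq (m i)] (M : ∀ i, Matrix (m i) (m i) k)
    (h : ∀ i, IsUnit (M i)) : IsUnit (Matrix.blockDiagonal' M) := by
  choose u hu using h
  refine IsUnit.of_mul_eq_one (Matrix.blockDiagonal' fun i => ((u i)⁻¹).val) ?_
  rw [← Matrix.blockDiagonal'_mul, ← Matrix.blockDiagonal'_one]
  congr 1
  funext i
  rw [← hu i]
  exact (u i).mul_inv

theorem MonicIrred.coeff_zero_ne {k : Type*} [Field k] (f : MonicIrred k) : f.1.coeff 0 ≠ 0 := by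
  intro h
  obtain ⟨hm, hi, hX⟩ := f.2
  exact hX (eq_of_monic_of_associated monic_X hm
    (Polynomial.irreducible_X.associated_of_dvd hi (X_dvd_iff.2 h))).symm

namespace PartitionFunction

variable {k : Type*} [Field k] {n : ℕ}

/-- An enumeration of the rows and columns of `g_μ`. -/
noncomputable def indexEquiv (μ : PartitionFunction k n) : μ.Index ≃ Fin n :=
  haveI : Finite μ.Support := μ.finite_support
  Finite.equivFinOfCardEq μ.natCard_index

theorem isUnit_jordanForm (μ : PartitionFunction k n) :
    IsUnit (Matrix.reindex μ.indexEquiv μ.indexEquiv μ.jordanForm) := by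
  classical
  have : Fintype μ.Support := μ.finite_support.fintype
  have h : IsUnit μ.jordanForm := by
    have h' : ∀ f : μ.Support, IsUnit (jordanPartition (μ.toFun f.1) f.1.1) := fun f =>
      isUnit_blockDiagonal' _ fun i => isUnit_jordanBlock f.1.coeff_zero_ne _
    exact isUnit_blockDiagonal' _ h'
  exact h.map (Matrix.reindexAlgEquiv k k μ.indexEquiv)

/-- The conjugacy class `c_μ` of `GL_n(k)`, the class of `g_μ`. It does not depend on the
enumeration of the rows and columns. -/
noncomputable def conjClass (μ : PartitionFunction k n) : ConjClasses (GL (Fin n) k) :=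
  ConjClasses.mk μ.isUnit_jordanForm.unit

end PartitionFunction

/-! ### The Galois action on partition-valued functions -/

/-- For `f = ∏ (t - x)` over an algebraic closure of `k`, the polynomial `∏ (t - x ^ r)`. -/
noncomputable def powRoots {k : Type*} [Field k] (r : ℕ) (f : k[X]) : (AlgebraicClosure k)[X] :=
  ((f.aroots (AlgebraicClosure k)).map fun x => X - C (x ^ r)).prod

namespace PartitionFunction

variable {k : Type*} [Field k] [Finite k] {n d : ℕ}

open Classical in
/-- The function `σ.μ : f ↦ μ(σ⁻¹.f)`, where `σ⁻¹.f` is the polynomial whose roots are the powers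
`x ^ r`, `x` a root of `f`, with the exponent `r` of `σ⁻¹`. If `deg f ≤ n`, then `σ⁻¹.f` is
again one of the irreducible polynomials on which `μ` is defined. For `deg f > n` it can be a
proper power of such a polynomial; the value is the empty partition then. -/
noncomputable def galAct (σ : CyclotomicGal (Nat.card (GL (Fin n) k)) d)
    (μ : PartitionFunction k n) : MonicIrred k → AllPartitions := fun f =>
  if h : ∃ g : MonicIrred k,
      g.1.map (algebraMap k (AlgebraicClosure k)) = powRoots (galExponent σ⁻¹) f.1
  then μ.toFun h.choose else AllPartitions.empty

/-- The orbit `O_d(μ) = {σ.μ : σ ∈ Gal(|GL_n(k)|, d)}`. -/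
def galOrbit (d : ℕ) (μ : PartitionFunction k n) : Set (MonicIrred k → AllPartitions) :=
  Set.range fun σ : CyclotomicGal (Nat.card (GL (Fin n) k)) d => galAct σ μ

end PartitionFunction

/-! The map `μ ↦ c_μ` is injective and equivariant: the class of `σ.μ` is obtained from `c_μ` by
raising representatives to the power `r = r_σ`. Given this, two classes lie in one Galois class
exactly when some `σ` moves `μ` to `ν`, that is, when the orbits agree.

Injectivity (`conjClass_injective`): for `f` irreducible, the kernel of `f(g_μ)^j` has dimension
`deg f` times the sum of `min(j, part)` over the parts of `μ(f)`. These dimensions are similarity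
invariants, and their second differences in `j` give the multiplicities of the parts.

Equivariance (`conjClass_galSMul`): it suffices to treat one Jordan block `J_m(f)`, where the `r`-th
powers of the roots of `f` are the roots of an irreducible `h` of the same degree. Write `J_m(f) = D
+ N` with `D` the block diagonal of companion matrices and `N` the commuting block shift.
First-order Taylor expansion of `P = h(t^r)` gives `P(D + N) = N u` with `u = P'(D) + N w`, a unit
as soon as `P'` is prime to `f`. Hence `h(J_m(f)^r)` is nilpotent of exact order `m`, and a matrix
of size `m deg h` with this property is multiplication by `t` on `k[t]/(h^m)`, so it is similar to
`J_m(h)` (`similar_jordanBlock_pow`).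

Coprimality with `P'` needs `r` nonzero in `k`. For `n ≥ 2` the characteristic divides `|GL_n|`,
which is prime to `r`; for `n ≤ 1` all blocks have `m ≤ 1`, so `N = 0` and no condition is needed.
-/

/-! ### Similarity of square matrices -/

namespace Matrix

variable {k : Type*} [Field k]

/-- Two square matrices, possibly with different index types, are similar if an isomorphism of the
coordinate spaces carries one to the other. -/
def Similar {ι κ : Type*} [Fintype ι] [Fintype κ] (A : Matrix ι ι k) (B : Matrix κ κ k) : Prop :=
  ∃ e : (ι → k) ≃ₗ[k] (κ → k), ∀ v, e (A *ᵥ v) = B *ᵥ e v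

namespace Similar

variable {ι κ τ : Type*} [Fintype ι] [Fintype κ] [Fintype τ]
  {A : Matrix ι ι k} {B : Matrix κ κ k} {C : Matrix τ τ k}

theorem symm (h : Similar A B) : Similar B A := by
  obtain ⟨e, he⟩ := h
  refine ⟨e.symm, fun v => e.injective ?_⟩
  rw [he, e.apply_symm_apply, e.apply_symm_apply]

theorem trans (h : Similar A B) (h' : Similar B C) : Similar A C := by
  obtain ⟨e, he⟩ := h
  obtain ⟨e', he'⟩ := h'
  exact ⟨e.trans e', fun v => by simp [he, he']⟩

theorem submatrix (A : Matrix ι ι k) (ε : κ ≃ ι) : Similar (A.submatrix ε ε) A := by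
  refine ⟨LinearEquiv.funCongrLeft k k ε.symm, fun v => ?_⟩
  rw [submatrix_mulVec_equiv]
  funext i
  simp [LinearEquiv.funCongrLeft, LinearMap.funLeft]

theorem pow [DecidableEq ι] [DecidableEq κ] (h : Similar A B) (r : ℕ) :
    Similar (A ^ r) (B ^ r) := by
  obtain ⟨e, he⟩ := h
  refine ⟨e, ?_⟩
  induction r with
  | zero => simp
  | succ r ih => intro v; rw [pow_succ, ← mulVec_mulVec, ih, he, mulVec_mulVec, ← pow_succ]

theorem aeval [DecidableEq ι] [DecidableEq κ] (h : Similar A B) (p : k[X]) :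
    Similar (Polynomial.aeval A p) (Polynomial.aeval B p) := by
  obtain ⟨e, he⟩ := h
  refine ⟨e, ?_⟩
  induction p using Polynomial.induction_on with
  | C a => intro v; simp [Algebra.algebraMap_eq_smul_one, smul_mulVec]
  | add p q hp hq => intro v; simp [add_mulVec, hp, hq]
  | monomial n a ih =>
    intro v
    rw [pow_succ, ← mul_assoc, map_mul _ (_ * _) X, map_mul _ (_ * _) X, aeval_X, aeval_X,
      ← mulVec_mulVec, ih, he, mulVec_mulVec]

/-- Similar matrices of the same size are conjugate. -/
theorem isConj [DecidableEq ι] {g h : GL ι k} (H : Similar g.1 h.1) : IsConj g h := by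
  obtain ⟨e, he⟩ := H
  have h1 : LinearMap.toMatrix' (e : (ι → k) →ₗ[k] (ι → k)) *
      LinearMap.toMatrix' (e.symm : (ι → k) →ₗ[k] (ι → k)) = 1 := by
    rw [← LinearMap.toMatrix'_comp]; simp
  have h2 : LinearMap.toMatrix' (e.symm : (ι → k) →ₗ[k] (ι → k)) *
      LinearMap.toMatrix' (e : (ι → k) →ₗ[k] (ι → k)) = 1 := by
    rw [← LinearMap.toMatrix'_comp]; simp
  refine ⟨toUnits (⟨_, _, h1, h2⟩ : GL ι k), Units.ext ?_⟩
  refine Matrix.toLin'.injective (LinearMap.ext fun v => ?_)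
  simpa [Matrix.toLin'_mul] using he v

theorem of_isConj [DecidableEq ι] {g h : GL ι k} (H : IsConj g h) : Similar g.1 h.1 := by
  obtain ⟨c, rfl⟩ := isConj_iff.1 H
  refine ⟨LinearEquiv.ofLinearMap (toLin' c.1) (toLin' (c⁻¹).1)
    (by rw [← toLin'_mul, ← Units.val_mul, mul_inv_cancel, Units.val_one, toLin'_one])
    (by rw [← toLin'_mul, ← Units.val_mul, inv_mul_cancel, Units.val_one, toLin'_one]),
    fun v => ?_⟩
  rw [LinearEquiv.coe_ofLinearMap, toLin'_apply, toLin'_apply]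
  rw [mulVec_mulVec, mulVec_mulVec, ← Units.val_mul, ← Units.val_mul, inv_mul_cancel_right]

end Similar

/-! ### Block diagonal matrices -/

section BlockDiagonal

variable {o o' : Type*} [Fintype o] [Fintype o'] [DecidableEq o] [DecidableEq o']
  {m : o → Type*} {m' : o' → Type*} [∀ i, Fintype (m i)] [∀ i, Fintype (m' i)]

theorem blockDiagonal'_mulVec_apply (M : ∀ i, Matrix (m i) (m i) k) (v : (Σ i, m i) → k)
    (i : o) (a : m i) :
    (blockDiagonal' M *ᵥ v) ⟨i, a⟩ = (M i *ᵥ fun b => v ⟨i, b⟩) a := by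
  simp only [mulVec, dotProduct]
  rw [Fintype.sum_sigma, Finset.sum_eq_single i]
  · simp
  · intro j _ hj
    exact Finset.sum_eq_zero fun b _ => by rw [blockDiagonal'_apply_ne _ _ _ hj.symm, zero_mul]
  · simp

theorem Similar.blockDiagonal'_congr {n : o → Type*} [∀ i, Fintype (n i)]
    {M : ∀ i, Matrix (m i) (m i) k} {M' : ∀ i, Matrix (n i) (n i) k}
    (h : ∀ i, Similar (M i) (M' i)) : Similar (blockDiagonal' M) (blockDiagonal' M') := by
  choose e he using h
  refine ⟨(LinearEquiv.piCurry k fun i (_ : m i) => k) ≪≫ₗ LinearEquiv.piCongrRight e ≪≫ₗ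
    (LinearEquiv.piCurry k fun i (_ : n i) => k).symm, fun v => ?_⟩
  funext ⟨i, a⟩
  rw [blockDiagonal'_mulVec_apply]
  have h1 : (fun b => (blockDiagonal' M *ᵥ v) ⟨i, b⟩) = M i *ᵥ fun b => v ⟨i, b⟩ :=
    funext fun b => blockDiagonal'_mulVec_apply M v i b
  change e i (fun b => (blockDiagonal' M *ᵥ v) ⟨i, b⟩) a = (M' i *ᵥ e i fun b => v ⟨i, b⟩) a
  rw [h1, he]

/-- The reindexing `ε` is what lets a permutation of the irreducible polynomials rearrange the
blocks of a Jordan form. -/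
theorem Similar.blockDiagonal' {M : ∀ i, Matrix (m i) (m i) k} {M' : ∀ i, Matrix (m' i) (m' i) k}
    (ε : o ≃ o') (h : ∀ i, Similar (M i) (M' (ε i))) :
    Similar (Matrix.blockDiagonal' M) (Matrix.blockDiagonal' M') := by
  refine (blockDiagonal'_congr h).trans ?_
  convert Similar.submatrix (Matrix.blockDiagonal' M') (Equiv.sigmaCongrLeft (β := m') ε)
  ext ⟨i, a⟩ ⟨j, b⟩
  rw [submatrix_apply]
  change _ = Matrix.blockDiagonal' M' ⟨ε i, a⟩ ⟨ε j, b⟩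
  by_cases hij : i = j
  · subst hij
    simp
  · rw [blockDiagonal'_apply_ne _ _ _ hij, blockDiagonal'_apply_ne _ _ _ (ε.injective.ne hij)]

theorem aeval_blockDiagonal' [∀ i, DecidableEq (m i)] (M : ∀ i, Matrix (m i) (m i) k) (p : k[X]) :
    aeval (blockDiagonal' M) p = blockDiagonal' fun i => aeval (M i) p := by
  induction p using Polynomial.induction_on with
  | C a =>
    simp only [aeval_C, Algebra.algebraMap_eq_smul_one]
    rw [← blockDiagonal'_one, ← blockDiagonal'_smul]
    rfl
  | add p q hp hq => simp only [map_add, hp, hq]; rw [← blockDiagonal'_add]; rfl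
  | monomial n a ih =>
    simp only [pow_succ, ← mul_assoc]
    rw [map_mul, ih, aeval_X, ← blockDiagonal'_mul]
    simp only [map_mul, aeval_X]

end BlockDiagonal

/-! ### Nullity -/

/-- The dimension of the kernel of a square matrix. -/
noncomputable def nullity {ι : Type*} [Fintype ι] (A : Matrix ι ι k) : ℕ :=
  Module.finrank k (LinearMap.ker A.mulVecLin)

section Nullity

variable {ι κ : Type*} [Fintype ι] [Fintype κ]

theorem Similar.nullity_eq {A : Matrix ι ι k} {B : Matrix κ κ k} (h : Similar A B) :
    A.nullity = B.nullity := by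
  obtain ⟨e, he⟩ := h
  refine LinearEquiv.finrank_eq (e.ofSubmodules _ _ ?_)
  ext w
  simp only [Submodule.mem_map, LinearMap.mem_ker, mulVecLin_apply]
  constructor
  · rintro ⟨v, hv, rfl⟩
    simp [← he, hv]
  · intro hw
    refine ⟨e.symm w, e.injective ?_, by simp⟩
    rw [he]
    simp [hw]

theorem nullity_of_isUnit [DecidableEq ι] {A : Matrix ι ι k} (h : IsUnit A) : A.nullity = 0 := by
  have : LinearMap.ker A.mulVecLin = ⊥ :=
    LinearMap.ker_eq_bot.2 (mulVec_injective_iff_isUnit.2 h)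
  rw [nullity, this, finrank_bot]

theorem nullity_mul_of_isUnit [DecidableEq ι] {A u : Matrix ι ι k} (h : IsUnit u) :
    (u * A).nullity = A.nullity := by
  have : LinearMap.ker (u * A).mulVecLin = LinearMap.ker A.mulVecLin := by
    rw [mulVecLin_mul]
    exact LinearMap.ker_comp_of_ker_eq_bot _
      (LinearMap.ker_eq_bot.2 (mulVec_injective_iff_isUnit.2 h))
  rw [nullity, this, nullity]

theorem nullity_blockDiagonal' {o : Type*} [Fintype o] [DecidableEq o] {m : o → Type*}
    [∀ i, Fintype (m i)] (M : ∀ i, Matrix (m i) (m i) k) :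
    (blockDiagonal' M).nullity = ∑ i, (M i).nullity := by
  simp only [nullity]
  rw [← Module.finrank_pi_fintype]
  have h : ∀ v : (Σ i, m i) → k, blockDiagonal' M *ᵥ v = 0 ↔
      ∀ i, M i *ᵥ (fun b => v ⟨i, b⟩) = 0 := by
    intro v
    constructor
    · intro hv i
      funext a
      rw [← blockDiagonal'_mulVec_apply, hv]; rfl
    · intro hv
      funext ⟨i, a⟩
      rw [blockDiagonal'_mulVec_apply, hv]; rfl
  refine LinearEquiv.finrank_eq
    { toFun := fun v i => ⟨fun b => v.1 ⟨i, b⟩, (h v.1).1 v.2 i⟩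
      map_add' := fun _ _ => rfl
      map_smul' := fun _ _ => rfl
      invFun := fun w => ⟨fun x => (w x.1).1 x.2, (h _).2 fun i => (w i).2⟩
      left_inv := fun _ => rfl
      right_inv := fun _ => rfl }

end Nullity

/-! ### Cyclic matrices with primary minimal polynomial -/

/-- If `φ` is annihilated by `h ^ m` but not by `h ^ (m - 1)`, where `h` is irreducible and
`m * deg h` is the dimension, then the space is cyclic: some `v` has annihilator `(h ^ m)` and
generates. -/
theorem exists_cyclic_vector {ι : Type*} [Fintype ι] [DecidableEq ι] (A : Matrix ι ι k) {h : k[X]}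
    (hh : Irreducible h) {m : ℕ} (h0 : aeval A h ^ m = 0) (h1 : aeval A h ^ (m - 1) ≠ 0)
    (hcard : Fintype.card ι = m * h.natDegree) :
    ∃ φ : k[X] →ₗ[k] (ι → k), Function.Surjective φ ∧
      LinearMap.ker φ = (Ideal.span {h ^ m}).restrictScalars k ∧
      ∀ p, φ (X * p) = A *ᵥ φ p := by
  obtain ⟨v, hv⟩ : ∃ v, aeval A h ^ (m - 1) *ᵥ v ≠ 0 := by
    by_contra! H
    exact h1 (Matrix.toLin'.injective (LinearMap.ext fun v => by
      rw [toLin'_apply, H, map_zero, LinearMap.zero_apply]))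
  let φ : k[X] →ₗ[k] (ι → k) :=
    { toFun := fun p => aeval A p *ᵥ v
      map_add' := fun p q => by simp [add_mulVec]
      map_smul' := fun a p => by simp [smul_mulVec] }
  have hmul : ∀ p q, φ (p * q) = aeval A p *ᵥ φ q := fun p q => by
    simp [φ, mulVec_mulVec]
  let I : Ideal k[X] :=
    { carrier := {p | φ p = 0}
      add_mem' := fun {a b} (ha : φ a = 0) (hb : φ b = 0) => by simp [ha, hb]
      zero_mem' := by simp
      smul_mem' := fun c x (hx : φ x = 0) => by simp [hmul, hx] }
  have hI : I = Ideal.span {h ^ m} := by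
    have hm : h ^ m ∈ I := by
      change aeval A (h ^ m) *ᵥ v = 0
      rw [map_pow, h0, zero_mulVec]
    have hg := Ideal.span_singleton_generator I
    rw [← hg, Ideal.mem_span_singleton] at hm
    obtain ⟨i, hi, hassoc⟩ := (dvd_prime_pow hh.prime m).1 hm
    -- The annihilator of `v` is generated by some `h ^ i` with `i ≤ m`; `i < m` would put `h ^ (m -
    -- 1)` in it, against the choice of `v`.
    rw [← hg, Ideal.span_singleton_eq_span_singleton]
    rcases hi.lt_or_eq with hlt | rfl
    · refine absurd ?_ hv
      have : h ^ (m - 1) ∈ I := by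
        rw [← hg, Ideal.mem_span_singleton]
        exact hassoc.dvd.trans (pow_dvd_pow h (by omega))
      rw [← map_pow]
      exact this
    · exact hassoc
  have hker : LinearMap.ker φ = (Ideal.span {h ^ m}).restrictScalars k := by
    rw [← hI]; rfl
  refine ⟨φ, ?_, hker, fun p => by rw [hmul, aeval_X]⟩
  -- Surjectivity by dimension: the image is `k[X] / (h ^ m)`, of dimension `m * deg h`, the size of
  -- `A`.
  rw [← LinearMap.range_eq_top]
  apply Submodule.eq_top_of_finrank_eq
  rw [← φ.quotKerEquivRange.finrank_eq, hker, Module.finrank_fintype_fun_eq_card, hcard,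
    ← natDegree_pow]
  exact finrank_quotient_span_eq_natDegree

/-- Both matrices act as multiplication by `X` on the same cyclic module `k[X] / (h ^ m)`. -/
theorem Similar.of_irreducible_pow {ι κ : Type*} [Fintype ι] [DecidableEq ι] [Fintype κ]
    [DecidableEq κ] {A : Matrix ι ι k} {B : Matrix κ κ k} {h : k[X]}
    (hh : Irreducible h) {m : ℕ}
    (hA0 : Polynomial.aeval A h ^ m = 0) (hA1 : Polynomial.aeval A h ^ (m - 1) ≠ 0)
    (hB0 : Polynomial.aeval B h ^ m = 0) (hB1 : Polynomial.aeval B h ^ (m - 1) ≠ 0)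
    (hι : Fintype.card ι = m * h.natDegree) (hκ : Fintype.card κ = m * h.natDegree) :
    Similar A B := by
  obtain ⟨φ, hφs, hφk, hφ⟩ := exists_cyclic_vector A hh hA0 hA1 hι
  obtain ⟨ψ, hψs, hψk, hψ⟩ := exists_cyclic_vector B hh hB0 hB1 hκ
  let e := (φ.quotKerEquivOfSurjective hφs).symm ≪≫ₗ
    Submodule.quotEquivOfEq _ _ (hφk.trans hψk.symm) ≪≫ₗ ψ.quotKerEquivOfSurjective hψs
  have he : ∀ p, e (φ p) = ψ p := by
    intro p
    have : (φ.quotKerEquivOfSurjective hφs).symm (φ p) = Submodule.Quotient.mk p := by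
      rw [LinearEquiv.symm_apply_eq]; rfl
    simp only [e, LinearEquiv.trans_apply, this, Submodule.quotEquivOfEq_mk]
    rfl
  refine ⟨e, fun v => ?_⟩
  obtain ⟨p, rfl⟩ := hφs v
  rw [← hφ, he, he, hψ]

end Matrix

/-! ### Polynomials in a sum of commuting elements -/

section CommutingSum

variable {k R : Type*} [Field k] [Ring R] [Algebra k R]

theorem Commute.aeval_right {a b : R} (h : Commute a b) (Q : k[X]) : Commute a (aeval b Q) := by
  induction Q using Polynomial.induction_on' with
  | add p q hp hq => rw [map_add]; exact hp.add_right hq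
  | monomial n c =>
    rw [aeval_monomial]
    exact Commute.mul_right (Algebra.commutes c a).symm (h.pow_right n)

/-- Taylor expansion to first order. The remainder `w` must commute with `D` and `N` so that `P'(D)
+ N w` is later a unit plus a commuting nilpotent. -/
theorem exists_aeval_add_eq {D N : R} (hc : Commute D N) (P : k[X]) :
    ∃ w, Commute D w ∧ Commute N w ∧
      aeval (D + N) P = aeval D P + N * aeval D (derivative P) + N ^ 2 * w := by
  have hD := (Commute.refl D).aeval_right (k := k)
  have hN := hc.symm.aeval_right (k := k)
  induction P using Polynomial.induction_on with
  | C a => exact ⟨0, Commute.zero_right _, Commute.zero_right _, by simp⟩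
  | add p q hp hq =>
    obtain ⟨w, h1, h2, h3⟩ := hp
    obtain ⟨w', h1', h2', h3'⟩ := hq
    refine ⟨w + w', h1.add_right h1', h2.add_right h2', ?_⟩
    simp only [map_add, h3, h3']
    noncomm_ring
  | monomial n a ih =>
    rw [pow_succ, ← mul_assoc]
    generalize C a * X ^ n = p at ih
    obtain ⟨w, h1, h2, h3⟩ := ih
    refine ⟨w * D + aeval D (derivative p) + w * N,
      ((h1.mul_right (Commute.refl D)).add_right (hD _)).add_right (h1.mul_right hc),
      ((h2.mul_right hc.symm).add_right (hN _)).add_right (h2.mul_right (Commute.refl N)), ?_⟩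
    rw [map_mul, h3, derivative_mul, derivative_X, mul_one]
    simp only [map_add, map_mul, aeval_X]
    have e1 : aeval D p * N = N * aeval D p := (hN p).symm
    have e2 : N * aeval D (derivative p) * N = N ^ 2 * aeval D (derivative p) := by
      rw [mul_assoc, ← (hN (derivative p)).eq, sq, mul_assoc]
    simp only [mul_add, add_mul, e1, e2]
    noncomm_ring

/-- If `f(D) = 0` and `f` divides `P` but is prime to the derivative of `P`, then `P(D + N)` is a
unit multiple of `N`, for nilpotent `N` that commutes with `D`. -/
theorem exists_isUnit_aeval_add_eq_mul {D N : R} (hc : Commute D N) (hN : IsNilpotent N)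
    {f P : k[X]} (hf : aeval D f = 0) (hP : f ∣ P) (hcop : IsCoprime f (derivative P)) :
    ∃ u, IsUnit u ∧ Commute N u ∧ aeval (D + N) P = N * u := by
  obtain ⟨w, hDw, hNw, hw⟩ := exists_aeval_add_eq hc P
  have hP0 : aeval D P = 0 := by
    obtain ⟨Q, rfl⟩ := hP
    rw [map_mul, hf, zero_mul]
  have hND := hc.symm.aeval_right (derivative P)
  have hDw' := (hDw.symm.aeval_right (derivative P)).symm
  have hu : IsUnit (aeval D (derivative P)) := by
    obtain ⟨a, b, hab⟩ := hcop
    have h1 : aeval D b * aeval D (derivative P) = 1 := by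
      simpa [hf] using congrArg (aeval D) hab
    have h2 : aeval D (derivative P) * aeval D b = 1 := by
      rw [← map_mul, mul_comm, map_mul, h1]
    exact ⟨⟨_, _, h2, h1⟩, rfl⟩
  -- `P'(D)` is invertible by the Bézout identity and `f(D) = 0`; adding the commuting nilpotent `N
  -- * w` keeps it so.
  refine ⟨aeval D (derivative P) + N * w, ?_, ?_, ?_⟩
  · exact (hNw.isNilpotent_mul_right hN).isUnit_add_left_of_commute hu
      (hND.mul_left hDw'.symm)
  · exact hND.add_right ((Commute.refl N).mul_right hNw)
  · rw [hw, hP0, zero_add, mul_add, sq, mul_assoc]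

end CommutingSum

/-! ### Companion matrices and Jordan blocks -/

section JordanBlock

open Matrix Kronecker

variable {k : Type*} [Field k]

/-- With ones above the diagonal, the companion matrix shifts basis row vectors, so the first one is
cyclic for the action from the right. -/
theorem single_vecMul_companionMatrix_pow (f : k[X]) (h0 : 0 < f.natDegree) (i : ℕ)
    (hi : i < f.natDegree) :
    Pi.single (⟨0, h0⟩ : Fin f.natDegree) (1 : k) ᵥ* companionMatrix f ^ i =
      Pi.single ⟨i, hi⟩ 1 := by
  induction i with
  | zero => simp
  | succ i ih =>
    rw [pow_succ, ← vecMul_vecMul, ih (by omega), single_one_vecMul]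
    funext j
    simp [companionMatrix, hi.ne, Pi.single_apply, Fin.ext_iff]

/-- A monic polynomial annihilates its companion matrix. -/
theorem aeval_companionMatrix {f : k[X]} (hf : f.Monic) : aeval (companionMatrix f) f = 0 := by
  rcases Nat.eq_zero_or_pos f.natDegree with h0 | h0
  · have : IsEmpty (Fin f.natDegree) := by rw [h0]; infer_instance
    exact Subsingleton.elim _ _
  set A := companionMatrix f with hA
  have key : Pi.single (⟨0, h0⟩ : Fin f.natDegree) (1 : k) ᵥ* aeval A f = 0 := by
    rw [aeval_eq_sum_range, Finset.sum_range_succ, hf.coeff_natDegree, one_smul, vecMul_add]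
    have h1 : Pi.single (⟨0, h0⟩ : Fin f.natDegree) (1 : k) ᵥ* A ^ f.natDegree =
        fun j : Fin f.natDegree => -f.coeff (j : ℕ) := by
      obtain ⟨s, hs⟩ : ∃ s, f.natDegree = s + 1 := ⟨f.natDegree - 1, by omega⟩
      have hlt : s < f.natDegree := by omega
      have e : A ^ f.natDegree = A ^ s * A := by
        rw [← pow_succ]
        exact congrArg (A ^ ·) hs
      rw [e, ← vecMul_vecMul, single_vecMul_companionMatrix_pow f h0 s hlt, single_one_vecMul]
      funext j
      simp [hA, companionMatrix, hs]
    rw [h1, vecMul_sum]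
    funext j
    simp only [Pi.add_apply, Finset.sum_apply, Pi.zero_apply, vecMul_smul, Pi.smul_apply]
    rw [Finset.sum_range fun i => f.coeff i •
      (Pi.single (⟨0, h0⟩ : Fin f.natDegree) (1 : k) ᵥ* A ^ i) j, Finset.sum_eq_single j]
    · rw [single_vecMul_companionMatrix_pow f h0 _ j.2]
      simp
    · intro i _ hi
      rw [single_vecMul_companionMatrix_pow f h0 _ i.2]
      simp [hi.symm]
    · simp
  -- Row `i` of `f(A)` is `e_0 A ^ i f(A) = e_0 f(A) A ^ i`, so `key` for the cyclic vector `e_0`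
  -- gives all rows.
  ext i j
  have h := congrArg (fun v => v ᵥ* A ^ (i : ℕ)) key
  simp only [vecMul_vecMul, zero_vecMul] at h
  have hcomm : aeval A f * A ^ (i : ℕ) = A ^ (i : ℕ) * aeval A f := by
    simpa using (((Commute.all f (X ^ (i : ℕ))).map (aeval A))).eq
  rw [hcomm, ← vecMul_vecMul, single_vecMul_companionMatrix_pow f h0 _ i.2,
    single_one_vecMul] at h
  exact congrFun h j

/-- The nilpotent matrix with ones right above the diagonal. -/
def shiftMatrix (k : Type*) [Field k] (m : ℕ) : Matrix (Fin m) (Fin m) k :=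
  Matrix.of fun a b => if (b : ℕ) = a + 1 then 1 else 0

theorem shiftMatrix_pow_mulVec (m j : ℕ) (v : Fin m → k) (a : Fin m) :
    (shiftMatrix k m ^ j *ᵥ v) a = if h : (a : ℕ) + j < m then v ⟨a + j, h⟩ else 0 := by
  induction j generalizing a with
  | zero => simp
  | succ j ih =>
    rw [pow_succ', ← mulVec_mulVec]
    simp only [mulVec, dotProduct] at ih ⊢
    by_cases ha : (a : ℕ) + 1 < m
    · rw [Finset.sum_eq_single ⟨a + 1, ha⟩]
      · rw [ih]
        simp [shiftMatrix, add_assoc, add_comm 1 j]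
      · intro b _ hb
        have : (b : ℕ) ≠ a + 1 := fun e => hb (Fin.ext e)
        simp [shiftMatrix, this]
      · simp
    · rw [dif_neg (by omega)]
      refine Finset.sum_eq_zero fun b _ => ?_
      have : (b : ℕ) ≠ a + 1 := by omega
      simp [shiftMatrix, this]

theorem kronecker_pow {ι κ : Type*} [Fintype ι] [Fintype κ] [DecidableEq ι] [DecidableEq κ]
    (A : Matrix ι ι k) (B : Matrix κ κ k) (j : ℕ) : (A ⊗ₖ B) ^ j = (A ^ j) ⊗ₖ (B ^ j) := by
  induction j with
  | zero => simp
  | succ j ih => rw [pow_succ, ih, ← mul_kronecker_mul, ← pow_succ, ← pow_succ]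

theorem kronecker_one_mulVec {ι κ : Type*} [Fintype ι] [Fintype κ] [DecidableEq κ]
    (A : Matrix ι ι k) (v : ι × κ → k) (a : ι) (b : κ) :
    ((A ⊗ₖ (1 : Matrix κ κ k)) *ᵥ v) (a, b) = (A *ᵥ fun i => v (i, b)) a := by
  simp only [mulVec, dotProduct, Fintype.sum_prod_type, kronecker_apply]
  refine Finset.sum_congr rfl fun i _ => ?_
  rw [Finset.sum_eq_single b] <;> simp +contextual [one_apply, eq_comm]

theorem aeval_one_kronecker {ι κ : Type*} [Fintype ι] [Fintype κ] [DecidableEq ι] [DecidableEq κ]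
    (B : Matrix κ κ k) (p : k[X]) :
    aeval ((1 : Matrix ι ι k) ⊗ₖ B) p = 1 ⊗ₖ aeval B p := by
  induction p using Polynomial.induction_on' with
  | add p q hp hq => rw [map_add, map_add, hp, hq, kronecker_add]
  | monomial n a =>
    rw [aeval_monomial, aeval_monomial, kronecker_pow, one_pow,
      ← Algebra.smul_def, ← Algebra.smul_def, kronecker_smul]

/-- Splits the block into two commuting summands, one annihilated by `f` and one nilpotent. -/
theorem jordanBlock_eq (m : ℕ) (f : k[X]) :
    jordanBlock m f = (1 : Matrix (Fin m) (Fin m) k) ⊗ₖ companionMatrix f +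
      shiftMatrix k m ⊗ₖ (1 : Matrix (Fin f.natDegree) (Fin f.natDegree) k) := by
  ext ⟨a, i⟩ ⟨b, j⟩
  rw [Matrix.add_apply, kronecker_apply, kronecker_apply]
  by_cases hab : a = b
  · subst hab
    simp [jordanBlock, shiftMatrix]
  · by_cases hb : (b : ℕ) = a + 1 <;> simp [jordanBlock, shiftMatrix, hab, hb, one_apply]

theorem shiftMatrix_pow_self (m : ℕ) : shiftMatrix k m ^ m = 0 := by
  refine Matrix.toLin'.injective (LinearMap.ext fun v => funext fun a => ?_)
  rw [toLin'_apply, shiftMatrix_pow_mulVec]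
  simp

theorem shiftMatrix_kronecker_one_pow_ne_zero {m s : ℕ} (hm : 0 < m) (hs : 0 < s) :
    (shiftMatrix k m ⊗ₖ (1 : Matrix (Fin s) (Fin s) k)) ^ (m - 1) ≠ 0 := by
  intro h
  have h1 := congrFun (congrArg (· *ᵥ fun _ => (1 : k)) h) (⟨0, hm⟩, ⟨0, hs⟩)
  simp only [kronecker_pow, one_pow] at h1
  rw [kronecker_one_mulVec, shiftMatrix_pow_mulVec, dif_pos (by simp; omega)] at h1
  simp at h1

/-- The `j`-th power moves every block up by `j`, so its kernel consists of the vectors supported in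
the first `j` blocks, which is the kernel of restriction to the remaining coordinates. -/
theorem nullity_shiftMatrix_kronecker_one_pow (m s j : ℕ) :
    ((shiftMatrix k m ⊗ₖ (1 : Matrix (Fin s) (Fin s) k)) ^ j).nullity = min j m * s := by
  let T : Type := {a : Fin m // j ≤ (a : ℕ)} × Fin s
  let φ : (Fin m × Fin s → k) →ₗ[k] (T → k) :=
    LinearMap.funLeft k k fun x : T => (x.1.1, x.2)
  have hφ : Function.Surjective φ := by
    apply LinearMap.funLeft_surjective_of_injective
    rintro ⟨⟨a, ha⟩, i⟩ ⟨⟨b, hb⟩, j⟩ h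
    simpa [Prod.ext_iff, Subtype.ext_iff, T] using h
  have hker : LinearMap.ker ((shiftMatrix k m ⊗ₖ (1 : Matrix (Fin s) (Fin s) k)) ^ j).mulVecLin =
      LinearMap.ker φ := by
    ext v
    simp only [LinearMap.mem_ker, mulVecLin_apply, kronecker_pow, one_pow]
    constructor
    · intro h
      funext ⟨⟨a, ha⟩, i⟩
      have hlt : (a : ℕ) - j + j < m := by omega
      have h1 := congrFun h (⟨a - j, by omega⟩, i)
      rw [kronecker_one_mulVec, shiftMatrix_pow_mulVec, dif_pos hlt] at h1
      simpa [φ, LinearMap.funLeft, Nat.sub_add_cancel ha] using h1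
    · intro h
      funext ⟨a, i⟩
      rw [kronecker_one_mulVec, shiftMatrix_pow_mulVec]
      split_ifs with hlt
      · exact congrFun h (⟨⟨a + j, hlt⟩, by simp⟩, i)
      · rfl
  have hcard : Fintype.card {a : Fin m // j ≤ (a : ℕ)} = m - j := by
    rw [← Fintype.card_fin (m - j)]
    exact Fintype.card_congr
      { toFun := fun a => ⟨a.1 - j, by have := a.1.2; have := a.2; omega⟩
        invFun := fun b => ⟨⟨b + j, by omega⟩, by simp⟩
        left_inv := fun a => by ext; simp [Nat.sub_add_cancel a.2]
        right_inv := fun b => by ext; simp }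
  rw [nullity, hker]
  have h1 := φ.finrank_range_add_finrank_ker
  rw [LinearMap.range_eq_top.2 hφ, finrank_top, Module.finrank_fintype_fun_eq_card,
    Module.finrank_fintype_fun_eq_card, Fintype.card_prod, Fintype.card_prod, Fintype.card_fin,
    Fintype.card_fin, hcard] at h1
  have h2 : m * s = (m - j) * s + min j m * s := by
    rw [← add_mul]; congr 1; omega
  omega

/-- The Jordan block `J_m(f)` and its powers: if `f` divides `P` and is prime to the derivative of
`P`, then `P(J_m(f))` is a unit multiple of the block shift. -/
theorem exists_aeval_jordanBlock_eq {m : ℕ} {f P : k[X]} (hf : f.Monic) (hP : f ∣ P)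
    (hcop : m ≤ 1 ∨ IsCoprime f (derivative P)) :
    ∃ u, IsUnit u ∧ Commute (shiftMatrix k m ⊗ₖ (1 : Matrix (Fin f.natDegree) _ k)) u ∧
      aeval (jordanBlock m f) P = shiftMatrix k m ⊗ₖ 1 * u := by
  have hD : aeval ((1 : Matrix (Fin m) (Fin m) k) ⊗ₖ companionMatrix f) f = 0 := by
    rw [aeval_one_kronecker, aeval_companionMatrix hf, kronecker_zero]
  have hnil : (shiftMatrix k m ⊗ₖ (1 : Matrix (Fin f.natDegree) (Fin f.natDegree) k)) ^ m = 0 := by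
    rw [kronecker_pow, shiftMatrix_pow_self, zero_kronecker]
  rcases hcop with hm | hcop
  -- For `m ≤ 1` there is no nilpotent part, and both sides vanish whatever the derivative of `P`.
  · have hN : shiftMatrix k m ⊗ₖ (1 : Matrix (Fin f.natDegree) (Fin f.natDegree) k) = 0 := by
      rw [← pow_one (_ ⊗ₖ _)]
      exact pow_eq_zero_of_le hm hnil
    obtain ⟨Q, rfl⟩ := hP
    refine ⟨1, isUnit_one, Commute.one_right _, ?_⟩
    rw [jordanBlock_eq, hN, add_zero, map_mul, hD, zero_mul, zero_mul]
  · rw [jordanBlock_eq]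
    refine exists_isUnit_aeval_add_eq_mul ?_ ⟨m, hnil⟩ hD hP hcop
    rw [Commute, SemiconjBy, ← mul_kronecker_mul, ← mul_kronecker_mul, one_mul, mul_one, one_mul,
      mul_one]

theorem nullity_aeval_jordanBlock_self {f : k[X]} (hf : f.Monic)
    (hsep : f.Separable) (m j : ℕ) :
    (aeval (jordanBlock m f) f ^ j).nullity = min j m * f.natDegree := by
  obtain ⟨u, hu, hc, h⟩ := exists_aeval_jordanBlock_eq (m := m) hf dvd_rfl (Or.inr hsep)
  rw [h, hc.mul_pow, (hc.pow_pow j j).eq, nullity_mul_of_isUnit (hu.pow j),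
    nullity_shiftMatrix_kronecker_one_pow]

/-- `f ^ m` annihilates the block and `h` is prime to it, so Bézout inverts `h` of the block. -/
theorem nullity_aeval_jordanBlock_of_ne {f h : k[X]} (hf : f.Monic) (hfi : Irreducible f)
    (hsep : f.Separable) (hh : h.Monic) (hhi : Irreducible h) (hne : h ≠ f) (m j : ℕ) :
    (aeval (jordanBlock m f) h ^ j).nullity = 0 := by
  obtain ⟨u, hu, hc, H⟩ := exists_aeval_jordanBlock_eq (m := m) hf dvd_rfl (Or.inr hsep)
  have hzero : aeval (jordanBlock m f) (f ^ m) = 0 := by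
    rw [map_pow, H, hc.mul_pow, kronecker_pow, shiftMatrix_pow_self, zero_kronecker, zero_mul]
  have hcop : IsCoprime h (f ^ m) := by
    refine IsCoprime.pow_right (hhi.coprime_iff_not_dvd.2 fun hd => hne ?_)
    exact eq_of_monic_of_associated hh hf (hhi.associated_of_dvd hfi hd)
  refine nullity_of_isUnit (IsUnit.pow j ?_)
  obtain ⟨a, b, hab⟩ := hcop
  refine IsUnit.of_mul_eq_one_right (aeval (jordanBlock m f) a) ?_
  simpa [hzero] using congrArg (aeval (jordanBlock m f)) hab

/-- Evaluating `h` at the `r`-th power is evaluating `h(t ^ r)` at the block itself, which gives a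
unit times the block shift. So `h` of either matrix is nilpotent of exact order `m`, and the cyclic
criterion applies. -/
theorem similar_jordanBlock_pow {f h : k[X]} (hf : f.Monic) (hh : h.Monic) (hhi : Irreducible h)
    (hsep : h.Separable) (hdeg : f.natDegree = h.natDegree) {m r : ℕ} (hm : 0 < m)
    (hdvd : f ∣ h.comp (X ^ r))
    (hcop : m ≤ 1 ∨ IsCoprime f (derivative (h.comp (X ^ r)))) :
    Similar (jordanBlock m f ^ r) (jordanBlock m h) := by
  have hpos : 0 < h.natDegree := hhi.natDegree_pos
  obtain ⟨u, hu, hc, H⟩ := exists_aeval_jordanBlock_eq hf hdvd hcop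
  obtain ⟨u', hu', hc', H'⟩ := exists_aeval_jordanBlock_eq (m := m) hh dvd_rfl (Or.inr hsep)
  rw [aeval_comp, map_pow, aeval_X] at H
  refine Similar.of_irreducible_pow hhi (m := m) ?_ ?_ ?_ ?_ (by simp [hdeg]) (by simp)
  · rw [H, hc.mul_pow, kronecker_pow, shiftMatrix_pow_self, zero_kronecker, zero_mul]
  · rw [H, hc.mul_pow, ne_eq, (hu.pow (m - 1)).mul_left_eq_zero]
    exact shiftMatrix_kronecker_one_pow_ne_zero hm (hdeg ▸ hpos)
  · rw [H', hc'.mul_pow, kronecker_pow, shiftMatrix_pow_self, zero_kronecker, zero_mul]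
  · rw [H', hc'.mul_pow, ne_eq, (hu'.pow (m - 1)).mul_left_eq_zero]
    exact shiftMatrix_kronecker_one_pow_ne_zero hm hpos

end JordanBlock

/-! ### Power maps on irreducible polynomials over a finite field -/

namespace MonicIrred

variable {k : Type*} [Field k]

theorem monic (f : MonicIrred k) : f.1.Monic := f.2.1

theorem irreducible (f : MonicIrred k) : Irreducible f.1 := f.2.2.1

theorem exists_root (f : MonicIrred k) : ∃ x : AlgebraicClosure k, aeval x f.1 = 0 :=
  IsAlgClosed.exists_aeval_eq_zero _ _ f.irreducible.degree_pos.ne'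

theorem root_ne_zero (f : MonicIrred k) {x : AlgebraicClosure k} (hx : aeval x f.1 = 0) :
    x ≠ 0 := by
  rintro rfl
  refine f.coeff_zero_ne ?_
  simpa [aeval_def, eval₂_at_zero] using hx

theorem eq_minpoly (f : MonicIrred k) {x : AlgebraicClosure k} (hx : aeval x f.1 = 0) :
    f.1 = minpoly k x :=
  minpoly.eq_of_irreducible_of_monic f.irreducible hx f.monic

theorem eq_of_common_root {f g : MonicIrred k} {x : AlgebraicClosure k} (hf : aeval x f.1 = 0)
    (hg : aeval x g.1 = 0) : f = g :=
  Subtype.ext ((f.eq_minpoly hf).trans (g.eq_minpoly hg).symm)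

theorem eq_of_map_eq {f g : MonicIrred k} {p : (AlgebraicClosure k)[X]}
    (hf : f.1.map (algebraMap k (AlgebraicClosure k)) = p)
    (hg : g.1.map (algebraMap k (AlgebraicClosure k)) = p) : f = g :=
  Subtype.ext (map_injective _ (algebraMap k (AlgebraicClosure k)).injective (hf.trans hg.symm))

theorem natDegree_eq_of_map_eq_powRoots {f h : MonicIrred k} {r : ℕ}
    (H : h.1.map (algebraMap k (AlgebraicClosure k)) = powRoots r f.1) :
    h.1.natDegree = f.1.natDegree := by
  have h1 := congrArg natDegree H
  rw [natDegree_map, powRoots, ← Function.comp_def (fun y => X - C y) (fun x => x ^ r),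
    ← Multiset.map_map, natDegree_multiset_prod_X_sub_C_eq_card, Multiset.card_map] at h1
  rw [h1, IsAlgClosed.card_aroots_eq_natDegree]

open Classical in
/-- The polynomial over `k` whose roots are the `r`-th powers of the roots of `f`, for
`deg f ≤ n`; polynomials of larger degree are left alone. -/
noncomputable def powUpTo (n r : ℕ) (f : MonicIrred k) : MonicIrred k :=
  if h : f.1.natDegree ≤ n ∧ ∃ g : MonicIrred k,
    g.1.map (algebraMap k (AlgebraicClosure k)) = powRoots r f.1 then h.2.choose else f

theorem natDegree_powUpTo (n r : ℕ) (f : MonicIrred k) :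
    (powUpTo n r f).1.natDegree = f.1.natDegree := by
  unfold powUpTo
  split_ifs with h
  · exact natDegree_eq_of_map_eq_powRoots h.2.choose_spec
  · rfl

variable [Finite k]

theorem separable (f : MonicIrred k) : f.1.Separable :=
  PerfectField.separable_of_irreducible f.irreducible

/-- `x` lies in `k(x)`, a field with `q ^ deg f` elements. -/
theorem root_pow_card_pow (f : MonicIrred k) {x : AlgebraicClosure k} (hx : aeval x f.1 = 0) :
    x ^ Nat.card k ^ f.1.natDegree = x := by
  have hint : IsIntegral k x := ⟨f.1, f.monic, hx⟩
  have : FiniteDimensional k (IntermediateField.adjoin k {x}) :=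
    IntermediateField.adjoin.finiteDimensional hint
  have : Finite (IntermediateField.adjoin k {x}) := Module.finite_of_finite k
  have : Fintype (IntermediateField.adjoin k {x}) := Fintype.ofFinite _
  have h := FiniteField.pow_card (IntermediateField.AdjoinSimple.gen k x)
  rw [← Nat.card_eq_fintype_card, Module.natCard_eq_pow_finrank (K := k),
    IntermediateField.adjoin.finrank hint, ← f.eq_minpoly hx] at h
  simpa using congrArg (algebraMap _ (AlgebraicClosure k)) h

end MonicIrred

/-! ### Roots and the order of the general linear group -/

section CardGL

variable {k : Type*} [Field k] [Finite k] {n : ℕ}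

/-- The order formula contains the factor `q ^ n - q ^ (n - s) = q ^ (n - s) (q ^ s - 1)`. -/
theorem card_pow_sub_one_dvd_card_GL {s : ℕ} (hs : 0 < s) (hsn : s ≤ n) :
    Nat.card k ^ s - 1 ∣ Nat.card (GL (Fin n) k) := by
  have := Fintype.ofFinite k
  rw [Matrix.card_GL_field, Nat.card_eq_fintype_card]
  refine dvd_trans ?_ (Finset.dvd_prod_of_mem _ (Finset.mem_univ (⟨n - s, by omega⟩ : Fin n)))
  refine ⟨Fintype.card k ^ (n - s), ?_⟩
  rw [Nat.sub_mul, ← pow_add, one_mul]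
  simp [show s + (n - s) = n by omega]

/-- For `n ≥ 2` the factor `q ^ n - q` makes the characteristic divide the group order. For `n = 1`
the order is `q - 1` and this fails. -/
theorem natCast_ne_zero_of_coprime_card_GL (hn : 2 ≤ n) {r : ℕ}
    (hr : r.Coprime (Nat.card (GL (Fin n) k))) : (r : k) ≠ 0 := by
  have := Fintype.ofFinite k
  obtain ⟨p, hp⟩ := CharP.exists k
  have hp' : p.Prime := CharP.char_is_prime k p
  have hpq : p ∣ Fintype.card k := (CharP.cast_eq_zero_iff k p _).1 (Nat.cast_card_eq_zero k)
  rw [Ne, CharP.cast_eq_zero_iff k p]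
  refine fun hpr => hp'.one_lt.ne' (Nat.dvd_one.1 (hr ▸ Nat.dvd_gcd hpr ?_))
  rw [Matrix.card_GL_field]
  refine dvd_trans ?_ (Finset.dvd_prod_of_mem _ (Finset.mem_univ (⟨1, by omega⟩ : Fin n)))
  exact Nat.dvd_sub (dvd_pow hpq (by omega)) (dvd_pow hpq (by simp))

theorem MonicIrred.root_pow_card_GL (f : MonicIrred k) (hf : f.1.natDegree ≤ n)
    {x : AlgebraicClosure k} (hx : aeval x f.1 = 0) : x ^ Nat.card (GL (Fin n) k) = 1 := by
  obtain ⟨c, hc⟩ := card_pow_sub_one_dvd_card_GL (k := k) f.irreducible.natDegree_pos hf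
  have h1 : x ^ (Nat.card k ^ f.1.natDegree - 1) = 1 := by
    refine mul_right_cancel₀ (f.root_ne_zero hx) ?_
    rw [← pow_succ, Nat.sub_add_cancel (Nat.pos_of_ne_zero (pow_ne_zero _ Nat.card_pos.ne')),
      f.root_pow_card_pow hx, one_mul]
  rw [hc, pow_mul, h1, one_pow]

theorem MonicIrred.root_pow_eq_self (f : MonicIrred k) (hf : f.1.natDegree ≤ n)
    {x : AlgebraicClosure k} (hx : aeval x f.1 = 0) {r : ℕ}
    (hr : r ≡ 1 [MOD Nat.card (GL (Fin n) k)]) : x ^ r = x := by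
  conv_rhs => rw [← pow_one x]
  exact pow_eq_pow_of_modEq hr (f.root_pow_card_GL hf hx)

/-- If `r` is invertible modulo `|GL_n(k)|` and `deg f ≤ n`, the polynomial whose roots are the
`r`-th powers of the roots of `f` is again irreducible over `k`. -/
theorem MonicIrred.exists_map_eq_powRoots (f : MonicIrred k) (hf : f.1.natDegree ≤ n) {r r' : ℕ}
    (hr : r * r' ≡ 1 [MOD Nat.card (GL (Fin n) k)]) :
    ∃ h : MonicIrred k, h.1.map (algebraMap k (AlgebraicClosure k)) = powRoots r f.1 ∧
      ∀ x : AlgebraicClosure k, aeval x f.1 = 0 → aeval (x ^ r) h.1 = 0 := by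
  obtain ⟨x, hx⟩ := f.exists_root
  have hx0 := f.root_ne_zero hx
  have hint : IsIntegral k (x ^ r) := Algebra.IsIntegral.isIntegral _
  let h : MonicIrred k := ⟨minpoly k (x ^ r), minpoly.monic hint, minpoly.irreducible hint, by
    intro hX
    have := minpoly.aeval k (x ^ r)
    rw [hX, aeval_X] at this
    exact pow_ne_zero r hx0 this⟩
  have hroot : ∀ y : AlgebraicClosure k, aeval y f.1 = 0 → aeval (y ^ r) h.1 = 0 := by
    intro y hy
    have hd : f.1 ∣ h.1.comp (X ^ r) := by
      rw [f.eq_minpoly hx]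
      refine minpoly.dvd _ _ ?_
      rw [aeval_comp, map_pow, aeval_X]
      exact minpoly.aeval k (x ^ r)
    obtain ⟨Q, hQ⟩ := hd
    have := congrArg (aeval y) hQ
    rwa [aeval_comp, map_pow, aeval_X, map_mul, hy, zero_mul] at this
  have hdeg : h.1.natDegree = f.1.natDegree := by
    rw [f.eq_minpoly hx, ← IntermediateField.adjoin.finrank hint,
      ← IntermediateField.adjoin.finrank (Algebra.IsIntegral.isIntegral (R := k) x)]
    -- `x` is recovered as `(x ^ r) ^ r'`, so both elements generate the same field and have the
    -- same degree.
    have : IntermediateField.adjoin k {x ^ r} = IntermediateField.adjoin k {x} := by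
      apply le_antisymm <;> rw [IntermediateField.adjoin_simple_le_iff]
      · exact pow_mem (IntermediateField.mem_adjoin_simple_self k x) r
      · have := pow_mem (IntermediateField.mem_adjoin_simple_self k (x ^ r)) r'
        rwa [← pow_mul, f.root_pow_eq_self hf hx hr] at this
    rw [this]
  -- The power map is injective on the roots of the separable `f`, with inverse `y ↦ y ^ r'`; equal
  -- degrees then turn inclusion of root multisets into equality.
  have hroots : (f.1.aroots (AlgebraicClosure k)).map (· ^ r) =
      h.1.aroots (AlgebraicClosure k) := by
    refine Multiset.eq_of_le_of_card_le ((Multiset.le_iff_subset ?_).2 ?_) ?_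
    · refine Multiset.Nodup.map_on ?_ (nodup_aroots_iff_of_splits f.irreducible.ne_zero
        (IsAlgClosed.splits _) |>.2 f.separable)
      intro y hy z hz hyz
      have hy' := (mem_aroots.1 hy).2
      have hz' := (mem_aroots.1 hz).2
      rw [← f.root_pow_eq_self hf hy' hr, ← f.root_pow_eq_self hf hz' hr, pow_mul, pow_mul]
      exact congrArg (· ^ r') hyz
    · intro y hy
      obtain ⟨z, hz, rfl⟩ := Multiset.mem_map.1 hy
      exact mem_aroots.2 ⟨h.irreducible.ne_zero, hroot z (mem_aroots.1 hz).2⟩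
    · rw [Multiset.card_map, IsAlgClosed.card_aroots_eq_natDegree,
        IsAlgClosed.card_aroots_eq_natDegree, hdeg]
  refine ⟨h, ?_, hroot⟩
  rw [powRoots, ← Function.comp_def (fun y => X - C y) (fun x => x ^ r), ← Multiset.map_map, hroots]
  exact (IsAlgClosed.splits (h.1.map _)).eq_prod_roots_of_monic (h.monic.map _)

theorem MonicIrred.map_powUpTo (f : MonicIrred k) (hf : f.1.natDegree ≤ n) {r r' : ℕ}
    (hr : r * r' ≡ 1 [MOD Nat.card (GL (Fin n) k)]) :
    (powUpTo n r f).1.map (algebraMap k (AlgebraicClosure k)) = powRoots r f.1 := by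
  obtain ⟨g, hg, -⟩ := f.exists_map_eq_powRoots hf hr
  rw [powUpTo, dif_pos ⟨hf, g, hg⟩]
  exact Exists.choose_spec (p := fun g : MonicIrred k =>
    g.1.map (algebraMap k (AlgebraicClosure k)) = powRoots r f.1) ⟨g, hg⟩

theorem MonicIrred.aeval_powUpTo (f : MonicIrred k) (hf : f.1.natDegree ≤ n) {r r' : ℕ}
    (hr : r * r' ≡ 1 [MOD Nat.card (GL (Fin n) k)]) {x : AlgebraicClosure k}
    (hx : aeval x f.1 = 0) : aeval (x ^ r) (powUpTo n r f).1 = 0 := by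
  obtain ⟨g, hg, hroot⟩ := f.exists_map_eq_powRoots hf hr
  rw [eq_of_map_eq (f.map_powUpTo hf hr) hg]
  exact hroot x hx

theorem MonicIrred.powUpTo_powUpTo (f : MonicIrred k) {r r' : ℕ}
    (hr : r * r' ≡ 1 [MOD Nat.card (GL (Fin n) k)]) : powUpTo n r' (powUpTo n r f) = f := by
  by_cases hf : f.1.natDegree ≤ n
  · obtain ⟨x, hx⟩ := f.exists_root
    have h1 := f.aeval_powUpTo hf hr hx
    have h2 := (powUpTo n r f).aeval_powUpTo (n := n) (r := r') (r' := r)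
      (by rwa [natDegree_powUpTo]) (by rwa [mul_comm] at hr) h1
    rw [← pow_mul, f.root_pow_eq_self hf hx hr] at h2
    exact eq_of_common_root h2 hx
  · have h : ∀ s, powUpTo n s f = f := fun s => by rw [powUpTo, dif_neg fun h => hf h.1]
    rw [h, h]

/-- If `r * r' ≡ 1` modulo `|GL_n(k)|`, the power map with exponent `r` permutes the monic
irreducible polynomials of degree at most `n`. -/
noncomputable def MonicIrred.powPerm {r r' : ℕ} (hr : r * r' ≡ 1 [MOD Nat.card (GL (Fin n) k)]) :
    Equiv.Perm (MonicIrred k) where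
  toFun := powUpTo n r
  invFun := powUpTo n r'
  left_inv f := f.powUpTo_powUpTo hr
  right_inv f := f.powUpTo_powUpTo (by rwa [mul_comm] at hr)

/-- Coprimality of `f` to the derivative of `h(t ^ r)`, where the `r`-th powers of the roots of `f`
are roots of `h`. -/
theorem MonicIrred.isCoprime_derivative_comp {f h : MonicIrred k} {r : ℕ} (hr : (r : k) ≠ 0)
    (hdvd : f.1 ∣ h.1.comp (X ^ r)) : IsCoprime f.1 (derivative (h.1.comp (X ^ r))) := by
  rw [f.irreducible.coprime_iff_not_dvd]
  obtain ⟨x, hx⟩ := f.exists_root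
  have key : ∀ {P : k[X]}, f.1 ∣ P → aeval x P = 0 := by
    rintro _ ⟨Q, rfl⟩
    rw [map_mul, hx, zero_mul]
  have h1 := key hdvd
  rw [aeval_comp, map_pow, aeval_X] at h1
  intro hd
  have h2 := key hd
  -- The derivative at `x` is `r x ^ (r - 1) h'(x ^ r)`, and none of the three factors vanishes.
  rw [derivative_comp, derivative_X_pow, map_mul, aeval_comp, map_mul, aeval_C, map_pow, map_pow,
    aeval_X] at h2
  have h3 := h.separable.aeval_derivative_ne_zero h1
  have h4 : algebraMap k (AlgebraicClosure k) (r : k) ≠ 0 := by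
    simpa using (map_ne_zero (algebraMap k (AlgebraicClosure k))).2 hr
  exact mul_ne_zero (mul_ne_zero h4 (pow_ne_zero _ (f.root_ne_zero hx))) h3 h2

end CardGL

/-! ### Partitions are determined by truncated sums of parts -/

theorem Multiset.sum_map_min_succ (s : Multiset ℕ) (j : ℕ) :
    (s.map (min (j + 1))).sum = (s.map (min j)).sum + s.countP (j < ·) := by
  induction s using Multiset.induction_on with
  | empty => simp
  | cons a s ih =>
    simp only [Multiset.map_cons, Multiset.sum_cons, Multiset.countP_cons, ih]
    split_ifs <;> omega

theorem Multiset.countP_lt_eq (s : Multiset ℕ) (j : ℕ) :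
    s.countP (j < ·) = s.count (j + 1) + s.countP (j + 1 < ·) := by
  induction s using Multiset.induction_on with
  | empty => simp
  | cons a s ih =>
    simp only [Multiset.countP_cons, Multiset.count_cons, ih]
    split_ifs <;> omega

/-- First differences in `j` count the elements above `j`; differences of these counts are
multiplicities. Zeros are invisible to the sums and must be excluded. -/
theorem Multiset.eq_of_sum_map_min_eq {s t : Multiset ℕ} (hs : 0 ∉ s) (ht : 0 ∉ t)
    (h : ∀ j, (s.map (min j)).sum = (t.map (min j)).sum) : s = t := by
  have hP : ∀ j, s.countP (j < ·) = t.countP (j < ·) := by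
    intro j
    have h1 := h (j + 1)
    rw [sum_map_min_succ, sum_map_min_succ, h j] at h1
    omega
  ext a
  cases a with
  | zero => rw [count_eq_zero_of_notMem hs, count_eq_zero_of_notMem ht]
  | succ j =>
    have h1 := hP j
    rw [countP_lt_eq s, countP_lt_eq t, hP (j + 1)] at h1
    omega

namespace AllPartitions

theorem ext_parts {l l' : AllPartitions} (h : l.2.parts = l'.2.parts) : l = l' := by
  obtain ⟨m, p⟩ := l
  obtain ⟨m', p'⟩ := l'
  obtain rfl : m = m' := by rw [← p.parts_sum, ← p'.parts_sum]; exact congrArg _ h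
  exact congrArg _ (Nat.Partition.ext h)

theorem eq_empty_of_size_eq_zero {l : AllPartitions} (h : l.size = 0) : l = empty := by
  obtain ⟨m, p⟩ := l
  obtain rfl : m = 0 := h
  exact congrArg _ (Subsingleton.elim _ _)

theorem zero_notMem_parts (l : AllPartitions) : 0 ∉ l.2.parts :=
  fun h => (l.2.parts_pos h).false

theorem coe_partList (l : AllPartitions) : (l.partList : Multiset ℕ) = l.2.parts :=
  Multiset.sort_eq _ _

theorem get_partList_mem (l : AllPartitions) (i : Fin l.partList.length) :
    l.partList.get i ∈ l.2.parts := by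
  rw [← l.coe_partList, Multiset.mem_coe]
  exact List.get_mem _ _

theorem get_partList_pos (l : AllPartitions) (i : Fin l.partList.length) :
    0 < l.partList.get i := l.2.parts_pos (l.get_partList_mem i)

theorem get_partList_le_size (l : AllPartitions) (i : Fin l.partList.length) :
    l.partList.get i ≤ l.size := by
  rw [size, ← l.2.parts_sum]
  exact Multiset.le_sum_of_mem (l.get_partList_mem i)

theorem sum_partList_get (l : AllPartitions) (F : ℕ → ℕ) :
    ∑ i, F (l.partList.get i) = (l.2.parts.map F).sum := by
  rw [← l.coe_partList, Multiset.map_coe, Multiset.sum_coe, ← List.sum_ofFn]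
  congr 1
  exact List.ofFn_getElem_eq_map _ _

end AllPartitions

/-! ### Jordan forms: invariants and powers -/

namespace PartitionFunction

open Matrix

variable {k : Type*} [Field k] {n : ℕ}

theorem ext_toFun {μ ν : PartitionFunction k n} (h : μ.toFun = ν.toFun) : μ = ν := by
  cases μ; cases ν; cases h; rfl

theorem size_mul_natDegree_le (μ : PartitionFunction k n) (f : MonicIrred k) :
    (μ.toFun f).size * f.1.natDegree ≤ n := by
  conv_rhs => rw [← μ.norm_eq]
  refine single_le_finsum (f := fun f : MonicIrred k => (μ.toFun f).size * f.1.natDegree) f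
    (μ.finite_support.subset fun f hf => ?_) fun _ => Nat.zero_le _
  exact left_ne_zero_of_mul hf

theorem toFun_eq_empty (μ : PartitionFunction k n) {f : MonicIrred k} (hf : n < f.1.natDegree) :
    μ.toFun f = AllPartitions.empty := by
  refine AllPartitions.eq_empty_of_size_eq_zero (by_contra fun h => ?_)
  have := μ.size_mul_natDegree_le f
  have := Nat.le_mul_of_pos_left f.1.natDegree (Nat.pos_of_ne_zero h)
  omega

/-- Precomposition with a degree-preserving permutation of the irreducible polynomials. -/
def compPerm (μ : PartitionFunction k n) (E : Equiv.Perm (MonicIrred k))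
    (hE : ∀ f, (E f).1.natDegree = f.1.natDegree) : PartitionFunction k n where
  toFun f := μ.toFun (E f)
  finite_support := μ.finite_support.preimage E.injective.injOn
  norm_eq := by
    refine Eq.trans ?_ μ.norm_eq
    rw [← finsum_comp_equiv E (f := fun f => (μ.toFun f).size * f.1.natDegree)]
    exact finsum_congr fun f => by rw [hE]

noncomputable instance fintypeSupport (μ : PartitionFunction k n) : Fintype μ.Support :=
  μ.finite_support.fintype

theorem similar_unit_jordanForm (μ : PartitionFunction k n) :
    Similar μ.isUnit_jordanForm.unit.1 μ.jordanForm :=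
  Similar.submatrix μ.jordanForm μ.indexEquiv.symm

variable [Finite k]

open Classical in
-- Only the blocks belonging to `f` have a kernel; a block of size `m` contributes `min j m * deg
-- f`.
theorem nullity_aeval_jordanForm (μ : PartitionFunction k n) (f : MonicIrred k) (j : ℕ) :
    (aeval μ.jordanForm (f.1 ^ j)).nullity =
      ((μ.toFun f).2.parts.map (min j)).sum * f.1.natDegree := by
  have hblock : ∀ g : MonicIrred k, (aeval (jordanPartition (μ.toFun g) g.1) (f.1 ^ j)).nullity =
      if g = f then ((μ.toFun f).2.parts.map (min j)).sum * f.1.natDegree else 0 := by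
    intro g
    rw [jordanPartition, aeval_blockDiagonal', nullity_blockDiagonal']
    simp only [map_pow]
    split_ifs with h
    · subst h
      simp only [nullity_aeval_jordanBlock_self g.monic g.separable]
      rw [← Finset.sum_mul, (μ.toFun g).sum_partList_get]
    · refine Finset.sum_eq_zero fun i _ => ?_
      exact nullity_aeval_jordanBlock_of_ne g.monic g.irreducible g.separable f.monic
        f.irreducible (fun e => h (Subtype.ext e.symm)) _ _
  rw [jordanForm, aeval_blockDiagonal', nullity_blockDiagonal']
  simp only [hblock]
  by_cases hf : (μ.toFun f).size = 0
  · have h0 : (μ.toFun f).2.parts = 0 := by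
      rw [AllPartitions.eq_empty_of_size_eq_zero hf]
      rfl
    simp [h0]
  · rw [Finset.sum_eq_single (⟨f, hf⟩ : μ.Support)]
    · simp
    · intro g _ hg
      rw [if_neg fun e => hg (Subtype.ext e)]
    · simp

/-- Different partition-valued functions give different conjugacy classes. -/
theorem conjClass_injective :
    Function.Injective (conjClass : PartitionFunction k n → ConjClasses (GL (Fin n) k)) := by
  classical
  intro μ ν h
  have hsim : Similar μ.jordanForm ν.jordanForm :=
    (similar_unit_jordanForm μ).symm.trans
      ((Similar.of_isConj (ConjClasses.mk_eq_mk_iff_isConj.1 h)).trans (similar_unit_jordanForm ν))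
  refine ext_toFun (funext fun f => AllPartitions.ext_parts ?_)
  refine Multiset.eq_of_sum_map_min_eq (AllPartitions.zero_notMem_parts _)
    (AllPartitions.zero_notMem_parts _) fun j => ?_
  have h1 := (hsim.aeval (f.1 ^ j)).nullity_eq
  rw [nullity_aeval_jordanForm, nullity_aeval_jordanForm] at h1
  exact Nat.eq_of_mul_eq_mul_right f.irreducible.natDegree_pos h1

open Classical in
-- The divisibility says that `r`-th powers of roots of `E f` are roots of `f`. So powers of blocks
-- for `E f` become blocks for `f` with the same partition, which amounts to precomposing `μ` with
-- `E`.
theorem similar_jordanForm_pow (μ : PartitionFunction k n) (E : Equiv.Perm (MonicIrred k))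
    (hE : ∀ f, (E f).1.natDegree = f.1.natDegree) {r : ℕ}
    (hdvd : ∀ f : MonicIrred k, f.1.natDegree ≤ n → (E f).1 ∣ f.1.comp (X ^ r))
    (hr : 2 ≤ n → (r : k) ≠ 0) :
    Similar (μ.compPerm E hE).jordanForm (μ.jordanForm ^ r) := by
  rw [jordanForm, jordanForm, ← blockDiagonal'_pow]
  refine Similar.blockDiagonal' (E.subtypeEquiv fun _ => Iff.rfl) fun f => ?_
  change Similar (jordanPartition (μ.toFun (E f.1)) f.1.1)
    (jordanPartition (μ.toFun (E f.1)) (E f.1).1 ^ r)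
  rw [jordanPartition, jordanPartition, ← blockDiagonal'_pow]
  refine Similar.blockDiagonal'_congr fun i => Matrix.Similar.symm ?_
  have hsize := μ.size_mul_natDegree_le (E f.1)
  have hpos := (E f.1).irreducible.natDegree_pos
  have hpart := (μ.toFun (E f.1)).get_partList_le_size i
  have hf : f.1.1.natDegree ≤ n := by
    rw [← hE]
    exact (Nat.le_mul_of_pos_left _ (Nat.pos_of_ne_zero f.2)).trans hsize
  refine similar_jordanBlock_pow (E f.1).monic f.1.monic f.1.irreducible f.1.separable (hE _)
    ((μ.toFun (E f.1)).get_partList_pos i) (hdvd _ hf) ?_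
  -- A part of size at least 2 forces `n ≥ 2`, where `r` is nonzero in `k`.
  by_cases hm : (μ.toFun (E f.1)).partList.get i ≤ 1
  · exact Or.inl hm
  · refine Or.inr (MonicIrred.isCoprime_derivative_comp (hr ?_) (hdvd _ hf))
    have := Nat.le_mul_of_pos_right (μ.toFun (E f.1)).size hpos
    omega

end PartitionFunction

/-! ### The Galois action -/

section GalAction

variable {N d : ℕ} [NeZero N]

theorem galExponent_coprime (σ : CyclotomicGal N d) : (galExponent σ).Coprime N :=
  ZMod.val_coe_unit_coprime _

theorem natCast_galExponent (σ : CyclotomicGal N d) : (galExponent σ : ZMod N) =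
    ((IsCyclotomicExtension.zeta_spec N ℚ (CyclotomicField N ℚ)).autToPow
      (cyclotomicSubfield N d) σ : (ZMod N)ˣ) :=
  ZMod.natCast_zmod_val _

theorem galExponent_mul (σ τ : CyclotomicGal N d) :
    galExponent (σ * τ) ≡ galExponent τ * galExponent σ [MOD N] := by
  rw [← ZMod.natCast_eq_natCast_iff, Nat.cast_mul, natCast_galExponent, natCast_galExponent,
    natCast_galExponent, map_mul, Units.val_mul, mul_comm]

/-- Only a congruence: for `N = 1` the representative is `0`. -/
theorem galExponent_one : galExponent (1 : CyclotomicGal N d) ≡ 1 [MOD N] := by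
  rw [← ZMod.natCast_eq_natCast_iff, natCast_galExponent, map_one, Units.val_one, Nat.cast_one]

theorem galExponent_inv_mul (σ : CyclotomicGal N d) :
    galExponent σ⁻¹ * galExponent σ ≡ 1 [MOD N] :=
  (galExponent_mul σ σ⁻¹).symm.trans (by rw [mul_inv_cancel]; exact galExponent_one)

variable {G : Type*} [Group G] [Finite G]

theorem galConjClass_mul (σ τ : CyclotomicGal (Nat.card G) d) (c : ConjClasses G) :
    galConjClass (σ * τ) c = galConjClass σ (galConjClass τ c) := by
  induction c using Quotient.inductionOn with
  | h g =>
    refine congrArg ConjClasses.mk ?_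
    change g ^ _ = (g ^ _) ^ _
    rw [← pow_mul]
    exact pow_eq_pow_of_modEq (galExponent_mul σ τ) pow_card_eq_one'

theorem galConjClass_one (c : ConjClasses G) :
    galConjClass (1 : CyclotomicGal (Nat.card G) d) c = c := by
  induction c using Quotient.inductionOn with
  | h g =>
    refine congrArg ConjClasses.mk ?_
    conv_rhs => rw [← pow_one g]
    exact pow_eq_pow_of_modEq galExponent_one pow_card_eq_one'

/-- Two conjugacy classes lie in a common Galois class if and only if the Galois group moves one
to the other. -/
theorem exists_galoisClasses_iff (c c' : ConjClasses G) :
    (∃ K ∈ galoisClasses d G, c.carrier ⊆ K ∧ c'.carrier ⊆ K) ↔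
      ∃ σ : CyclotomicGal (Nat.card G) d, c' = galConjClass σ c := by
  constructor
  · rintro ⟨_, ⟨b, rfl⟩, h, h'⟩
    have key : ∀ a : ConjClasses G,
        a.carrier ⊆ (⋃ σ : CyclotomicGal (Nat.card G) d, (galConjClass σ b).carrier) →
        ∃ σ : CyclotomicGal (Nat.card G) d, a = galConjClass σ b := by
      intro a ha
      obtain ⟨g, rfl⟩ := ConjClasses.exists_rep a
      obtain ⟨σ, hσ⟩ := Set.mem_iUnion.1 (ha ConjClasses.mem_carrier_mk)
      exact ⟨σ, ConjClasses.mem_carrier_iff_mk_eq.1 hσ⟩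
    obtain ⟨σ, rfl⟩ := key c h
    obtain ⟨τ, rfl⟩ := key c' h'
    exact ⟨τ * σ⁻¹, by rw [← galConjClass_mul, inv_mul_cancel_right]⟩
  · rintro ⟨σ, rfl⟩
    refine ⟨_, ⟨c, rfl⟩, ?_, Set.subset_iUnion (fun τ : CyclotomicGal (Nat.card G) d =>
      (galConjClass τ c).carrier) σ⟩
    conv_lhs => rw [← galConjClass_one (d := d) c]
    exact Set.subset_iUnion (fun τ : CyclotomicGal (Nat.card G) d =>
      (galConjClass τ c).carrier) 1

end GalAction

/-! ### Equivariance and comparison of orbits -/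

namespace PartitionFunction

open Matrix

variable {k : Type*} [Field k] [Finite k] {n d : ℕ}

/-- The function `σ.μ` as a partition-valued function of the same norm. -/
noncomputable def galSMul (σ : CyclotomicGal (Nat.card (GL (Fin n) k)) d)
    (μ : PartitionFunction k n) : PartitionFunction k n :=
  μ.compPerm (MonicIrred.powPerm (galExponent_inv_mul σ)) (MonicIrred.natDegree_powUpTo n _)

theorem galAct_eq (σ : CyclotomicGal (Nat.card (GL (Fin n) k)) d) (μ : PartitionFunction k n) :
    galAct σ μ = (galSMul σ μ).toFun := by
  funext f
  change _ = μ.toFun (MonicIrred.powUpTo n (galExponent σ⁻¹) f)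
  by_cases hf : f.1.natDegree ≤ n
  · have h := f.map_powUpTo hf (galExponent_inv_mul σ)
    have hex : ∃ g : MonicIrred k,
        g.1.map (algebraMap k (AlgebraicClosure k)) = powRoots (galExponent σ⁻¹) f.1 := ⟨_, h⟩
    rw [galAct, dif_pos hex]
    exact congrArg μ.toFun (MonicIrred.eq_of_map_eq hex.choose_spec h)
  · rw [not_le] at hf
    rw [μ.toFun_eq_empty (hf.trans_eq (MonicIrred.natDegree_powUpTo n _ f).symm), galAct]
    split_ifs with h
    · refine μ.toFun_eq_empty (hf.trans_eq ?_)
      exact (MonicIrred.natDegree_eq_of_map_eq_powRoots h.choose_spec).symm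
    · rfl

/-- The inverse in `μ(σ⁻¹.f)` fits: the roots of `σ⁻¹.f` are powers of roots of `f` with the
exponent of `σ⁻¹`, and the exponent of `σ` brings them back. -/
theorem conjClass_galSMul (σ : CyclotomicGal (Nat.card (GL (Fin n) k)) d)
    (μ : PartitionFunction k n) :
    (galSMul σ μ).conjClass = galConjClass σ μ.conjClass := by
  classical
  refine ConjClasses.mk_eq_mk_iff_isConj.2 (Similar.isConj ?_)
  refine (similar_unit_jordanForm _).trans (Matrix.Similar.trans ?_
    ((similar_unit_jordanForm μ).pow (galExponent σ)).symm)
  refine similar_jordanForm_pow μ _ _ (fun f hf => ?_) fun hn =>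
    natCast_ne_zero_of_coprime_card_GL hn (galExponent_coprime σ)
  obtain ⟨x, hx⟩ := f.exists_root
  have h := f.aeval_powUpTo hf (galExponent_inv_mul σ) hx
  change (MonicIrred.powUpTo n (galExponent σ⁻¹) f).1 ∣ _
  rw [MonicIrred.eq_minpoly _ h]
  refine minpoly.dvd _ _ ?_
  rw [aeval_comp, map_pow, aeval_X, ← pow_mul,
    f.root_pow_eq_self hf hx (galExponent_inv_mul σ), hx]

/-- The laws of a group action on partition-valued functions are pulled back from conjugacy classes
along the injective equivariant map, with no further computation with polynomials. -/
theorem galOrbit_eq_iff (μ ν : PartitionFunction k n) :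
    galOrbit d μ = galOrbit d ν ↔
      ∃ σ : CyclotomicGal (Nat.card (GL (Fin n) k)) d, ν = galSMul σ μ := by
  have hsub : ∀ (σ : CyclotomicGal (Nat.card (GL (Fin n) k)) d) (μ : PartitionFunction k n),
      galOrbit d (galSMul σ μ) ⊆ galOrbit d μ := by
    rintro σ μ _ ⟨τ, rfl⟩
    refine ⟨τ * σ, ?_⟩
    simp only [galAct_eq]
    refine congrArg toFun (conjClass_injective ?_)
    simp only [conjClass_galSMul, galConjClass_mul]
  have hone : ∀ μ : PartitionFunction k n,
      galSMul (1 : CyclotomicGal (Nat.card (GL (Fin n) k)) d) μ = μ := fun μ =>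
    conjClass_injective (by rw [conjClass_galSMul, galConjClass_one])
  constructor
  · intro h
    have hν : ν.toFun ∈ galOrbit d ν := ⟨1, by simp only [galAct_eq, hone]⟩
    rw [← h] at hν
    obtain ⟨σ, hσ⟩ := hν
    exact ⟨σ, ext_toFun (hσ.symm.trans (galAct_eq σ μ))⟩
  · rintro ⟨σ, rfl⟩
    refine (Set.Subset.antisymm (hsub σ μ) ?_).symm
    have h : galSMul σ⁻¹ (galSMul σ μ) = μ := conjClass_injective (by
      rw [conjClass_galSMul, conjClass_galSMul, ← galConjClass_mul, inv_mul_cancel,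
        galConjClass_one])
    conv_lhs => rw [← h]
    exact hsub σ⁻¹ _

end PartitionFunction

theorem mainTheorem5 {k : Type*} [Field k] [Finite k] (n d : ℕ) (hd : 0 < d)
    (hdvd : d ∣ Nat.card (GL (Fin n) k) ∨ Nat.card (GL (Fin n) k) ∣ d)
    (μ ν : PartitionFunction k n) :
    (∃ K ∈ galoisClasses d (GL (Fin n) k), μ.conjClass.carrier ⊆ K ∧ ν.conjClass.carrier ⊆ K) ↔
      PartitionFunction.galOrbit d μ = PartitionFunction.galOrbit d ν := by
  rw [exists_galoisClasses_iff, PartitionFunction.galOrbit_eq_iff]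
  refine exists_congr fun σ => ?_
  rw [← PartitionFunction.conjClass_galSMul, PartitionFunction.conjClass_injective.eq_iff]
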